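/- An MV-algebra is an algebra $\mathbf M=(M;\oplus,\neg,0)$ of type $(2,1,0)$ such that, with $1:=\neg 0$, for all $x,y,z\in M$: $x\oplus y=y\oplus x$, $x\oplus(y\oplus z)=(x\oplus y)\oplus z$, $x\oplus 0=x$, $\neg\neg x=x$, $x\oplus 1=1$ and $\neg(\neg x\oplus y)\oplus y=\neg(\neg y\oplus x)\oplus x$. It is ordered by $x\le y$ iff $\neg x\oplus y=1$. The set $\mathbb Q\cap[0,1]$ is an MV-algebra with $x\oplus y=\min\{x+y,1\}$, $\neg x=1-x$ and $0$, and for an integer $k\ge 1$ the finite MV-chain $\mathbf L_k$ is its subalgebra on $\{0,\frac1k,\frac2k,\dots,1\}$. For $X\subseteq M$, the restriction $\mathbf M|_X$ is the partial algebra on $X$ in which an operation ($\oplus$, $\neg$ or the constant $0$) is defined at given arguments from $X$ if and only if its value in $\mathbf M$ belongs to $X$, and then has this value. An embedding of $\mathbf M|_X$ into an MV-algebra $\mathbf B$ is an injective map $f:X\to B$ that preserves each operation wherever it is defined in $\mathbf M|_X$. **Embedding Lemma.** Let $\mathbf M$ be a linearly ordered MV-algebra with $0\neq 1$ and let $X\subseteq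 M$ be a finite set. Then there exist an integer $k\ge 1$ and an embedding $f:\mathbf M|_X\hookrightarrow\mathbf L_k$; composed with the inclusion $\mathbf L_k\subseteq\mathbb Q\cap[0,1]$, the map $f$ is also an embedding of $\mathbf M|_X$ into $\mathbb Q\cap[0,1]$. -/

import Mathlib

/-- An MV-algebra `(A, ⊕, ¬, 0)`, an algebra of type `(2, 1, 0)`. -/
class MVAlgebra (A : Type*) where
  oplus : A → A → A
  neg : A → A
  zero : A
  oplus_comm : ∀ x y, oplus x y = oplus y x
  oplus_assoc : ∀ x y z, oplus x (oplus y z) = oplus (oplus x y) z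
  oplus_zero : ∀ x, oplus x zero = x
  neg_neg : ∀ x, neg (neg x) = x
  oplus_one : ∀ x, oplus x (neg zero) = neg zero
  lukasiewicz : ∀ x y, oplus (neg (oplus (neg x) y)) y = oplus (neg (oplus (neg y) x)) x

namespace MVAlgebra

/-- The top element `1 := ¬0`. -/
def one {A : Type*} [MVAlgebra A] : A := neg zero

/-- The natural order: `x ≤ y` iff `¬x ⊕ y = 1`. -/
def le {A : Type*} [MVAlgebra A] (x y : A) : Prop := oplus (neg x) y = one

/-- `A` is linearly ordered (an MV-chain) by its natural order. -/
def IsLinearlyOrdered (A : Type*) [MVAlgebra A] : Prop := ∀ x y : A, le x y ∨ le y x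

/-- `ℚ ∩ [0,1]` with `x ⊕ y = min (x + y) 1` and `¬x = 1 - x`. -/
instance ratUnit : MVAlgebra (Set.Icc (0 : ℚ) 1) where
  oplus x y := ⟨min (x.1 + y.1) 1, le_min (add_nonneg x.2.1 y.2.1) zero_le_one, min_le_right _ _⟩
  neg x := ⟨1 - x.1, sub_nonneg.2 x.2.2, sub_le_self _ x.2.1⟩
  zero := ⟨0, le_rfl, zero_le_one⟩
  oplus_comm x y := by simp only [add_comm]
  oplus_assoc x y z := by
    apply Subtype.ext
    change min ((x : ℚ) + min ((y : ℚ) + z) 1) 1 = min (min ((x : ℚ) + y) 1 + z) 1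
    have hx := x.2.1
    have hz := z.2.1
    rcases min_cases ((y : ℚ) + z) 1 with h | h <;> rcases min_cases ((x : ℚ) + y) 1 with h' | h' <;>
      rw [h.1, h'.1]
    · rw [add_assoc]
    · rw [min_eq_right (by linarith), min_eq_right (by linarith)]
    · rw [min_eq_right (by linarith), min_eq_right (by linarith)]
    · rw [min_eq_right (by linarith), min_eq_right (by linarith)]
  oplus_zero x := by
    apply Subtype.ext
    change min ((x : ℚ) + 0) 1 = x
    rw [add_zero, min_eq_left x.2.2]
  neg_neg x := Subtype.ext (sub_sub_cancel 1 (x : ℚ))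
  oplus_one x := by
    apply Subtype.ext
    change min ((x : ℚ) + (1 - 0)) 1 = 1 - 0
    rw [sub_zero, min_eq_right (le_add_of_nonneg_left x.2.1)]
  lukasiewicz x y := by
    apply Subtype.ext
    change min (1 - min (1 - (x : ℚ) + y) 1 + y) 1 = min (1 - min (1 - (y : ℚ) + x) 1 + x) 1
    congr 1
    rcases le_total (x : ℚ) y with h | h
    · rw [min_eq_right (by linarith), min_eq_left (by linarith)]
      ring
    · rw [min_eq_left (by linarith), min_eq_right (by linarith)]
      ring

/-- The set `{0, 1/k, 2/k, …, 1}`, for an integer `k ≥ 1`. -/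
abbrev FiniteChain (k : ℕ+) : Type :=
  {q : Set.Icc (0 : ℚ) 1 // ∃ i : ℕ, i ≤ (k : ℕ) ∧ (q : ℚ) = (i : ℚ) / ((k : ℕ) : ℚ)}

/-- The finite MV-chain `L_k`, with the operations inherited from `ℚ ∩ [0,1]`. -/
instance finiteChain (k : ℕ+) : MVAlgebra (FiniteChain k) where
  oplus x y := ⟨oplus x.1 y.1, by
    obtain ⟨x, i, hi, hx⟩ := x
    obtain ⟨y, j, hj, hy⟩ := y
    have hk : (0 : ℚ) < ((k : ℕ) : ℚ) := by exact_mod_cast k.pos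
    refine ⟨min (i + j) k, min_le_right _ _, ?_⟩
    change min ((x : ℚ) + (y : ℚ)) 1 = _
    rw [hx, hy, Nat.cast_min, Nat.cast_add, ← min_div_div_right hk.le, div_self hk.ne', add_div]⟩
  neg x := ⟨neg x.1, by
    obtain ⟨x, i, hi, hx⟩ := x
    have hk : (0 : ℚ) < ((k : ℕ) : ℚ) := by exact_mod_cast k.pos
    refine ⟨(k : ℕ) - i, Nat.sub_le _ _, ?_⟩
    change 1 - (x : ℚ) = _
    rw [hx, Nat.cast_sub hi, sub_div, div_self hk.ne']⟩
  zero := ⟨zero, 0, Nat.zero_le _, by change (0 : ℚ) = _; simp⟩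
  oplus_comm x y := Subtype.ext (oplus_comm x.1 y.1)
  oplus_assoc x y z := Subtype.ext (oplus_assoc x.1 y.1 z.1)
  oplus_zero x := Subtype.ext (oplus_zero x.1)
  neg_neg x := Subtype.ext (neg_neg x.1)
  oplus_one x := Subtype.ext (oplus_one x.1)
  lukasiewicz x y := Subtype.ext (lukasiewicz x.1 y.1)

end MVAlgebra

/-- A partial algebra of type `(2, 1, 0)` on the set `A`. -/
structure PartialMVAlgebra (A : Type*) where
  oplus : A → A → Part A
  neg : A → Part A
  zero : Part A

namespace PartialMVAlgebra

/-- The restriction of an MV-algebra to a subset `X`: an operation is defined at arguments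
from `X` exactly when its value in the MV-algebra lies in `X`, and then has that value. -/
def restrict (M : Type*) [MVAlgebra M] (X : Set M) : PartialMVAlgebra X where
  oplus x y := ⟨MVAlgebra.oplus x.1 y.1 ∈ X, fun h => ⟨MVAlgebra.oplus x.1 y.1, h⟩⟩
  neg x := ⟨MVAlgebra.neg x.1 ∈ X, fun h => ⟨MVAlgebra.neg x.1, h⟩⟩
  zero := ⟨MVAlgebra.zero ∈ X, fun h => ⟨MVAlgebra.zero, h⟩⟩

/-- An embedding of a partial algebra into an MV-algebra: an injective map preserving
every operation wherever it is defined. -/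
structure IsEmbedding {A B : Type*} [MVAlgebra B] (P : PartialMVAlgebra A) (f : A → B) :
    Prop where
  injective : Function.Injective f
  map_oplus : ∀ x y, ∀ z ∈ P.oplus x y, f z = MVAlgebra.oplus (f x) (f y)
  map_neg : ∀ x, ∀ z ∈ P.neg x, f z = MVAlgebra.neg (f x)
  map_zero : ∀ z ∈ P.zero, f z = MVAlgebra.zero

end PartialMVAlgebra

/-! A nontrivial MV-chain is the interval `[0, u]` of a linearly ordered abelian group, with `x ⊕ y
= min (x + y) u` and `¬x = u - x` (`exists_orderedGroup_embedding`). The group consists of formal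
sums `n · 1 + x` with `x ≠ 1`, added with carry.

An additive map `φ` to `ℚ` respects these formulas on `X` once it preserves the order among `0`,
`u`, the elements of `X` and their pairwise sums. These are finitely many strict inequalities, and
Fourier–Motzkin elimination solves them over `ℚ` (`exists_addMonoidHom_rat_strictMonoOn`). Dividing
by `φ u` lands in `ℚ ∩ [0,1]`, and a common denominator of the finitely many values is the required
`k`. -/

/-! ### Homomorphisms from linearly ordered abelian groups to `ℚ` -/

section OrderedGroup

variable {G : Type*} [AddCommGroup G] [LinearOrder G] [IsOrderedAddMonoid G]

/-- Fourier–Motzkin elimination for vectors with positive image in an ordered group. -/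
theorem exists_addMonoidHom_rat_pos_of_pi (n : ℕ) (h : (Fin n → ℤ) →+ G)
    (S : Finset (Fin n → ℤ)) (hS : ∀ s ∈ S, 0 < h s) :
    ∃ φ : (Fin n → ℤ) →+ ℚ, ∀ s ∈ S, 0 < φ s := by
  classical
  induction n with
  | zero =>
    refine ⟨0, fun s hs => absurd (hS s hs) ?_⟩
    rw [Subsingleton.elim s 0, map_zero]
    exact lt_irrefl _
  | succ n ih =>
    let j : (Fin n → ℤ) →+ (Fin (n + 1) → ℤ) :=
      { toFun := fun w => Fin.cons 0 w
        map_zero' := by ext i; refine Fin.cases ?_ (fun i => ?_) i <;> simp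
        map_add' := fun v w => by ext i; refine Fin.cases ?_ (fun i => ?_) i <;> simp }
    let r : (Fin (n + 1) → ℤ) →+ (Fin n → ℤ) :=
      { toFun := fun v i => v i.succ
        map_zero' := rfl
        map_add' := fun _ _ => rfl }
    let e : Fin (n + 1) → ℤ := Pi.single 0 1
    have hdec (s : Fin (n + 1) → ℤ) : s = j (r s) + s 0 • e := by
      ext i
      refine Fin.cases ?_ (fun i => ?_) i <;> simp [j, r, e]
    have hval (s : Fin (n + 1) → ℤ) : h s = h (j (r s)) + s 0 • h e := by
      conv_lhs => rw [hdec s, map_add, map_zsmul]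
    -- The constraints left after eliminating coordinate 0: vectors not involving `e`, and positive
    -- combinations of two vectors with opposite signs in which `e` cancels.
    let T : Finset (Fin n → ℤ) := (S.filter (fun s => s 0 = 0)).image r ∪
      ((S.filter (fun s => 0 < s 0)) ×ˢ (S.filter (fun s => s 0 < 0))).image
        (fun p => (-p.2 0) • r p.1 + p.1 0 • r p.2)
    obtain ⟨ψ, hψ⟩ := ih (h.comp j) T (by
      intro w hw
      simp only [T, Finset.mem_union, Finset.mem_image, Finset.mem_filter, Finset.mem_product,
        Prod.exists] at hw
      rcases hw with ⟨s, ⟨hs, h0⟩, rfl⟩ | ⟨p, q, ⟨⟨hp, hp0⟩, hq, hq0⟩, rfl⟩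
      · have := hS s hs
        rwa [hval s, h0, zero_smul, add_zero] at this
      · have key : (h.comp j) ((-q 0) • r p + p 0 • r q) = (-q 0) • h p + p 0 • h q := by
          rw [hval p, hval q]
          simp only [AddMonoidHom.comp_apply, map_add, map_zsmul, smul_add, smul_smul]
          have : (-q 0 * p 0) • h e + (p 0 * q 0) • h e = 0 := by
            rw [← add_smul, show -q 0 * p 0 + p 0 * q 0 = 0 by ring, zero_smul]
          rw [add_add_add_comm, this, add_zero]
        rw [key]
        exact add_pos (zsmul_pos (hS p hp) (by omega)) (zsmul_pos (hS q hq) hp0))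
    -- `t` will be the value at `e`. Vectors with positive coordinate 0 bound it below, those with
    -- negative one above; positivity of `ψ` on `T` makes the bounds compatible.
    obtain ⟨t, hlo, hhi⟩ := Order.exists_between_finsets
      ((S.filter (fun s => 0 < s 0)).image (fun s => -ψ (r s) / (s 0 : ℚ)))
      ((S.filter (fun s => s 0 < 0)).image (fun s => ψ (r s) / (-s 0 : ℚ))) (by
        simp only [Finset.mem_image, Finset.mem_filter]
        rintro _ ⟨p, ⟨hp, hp0⟩, rfl⟩ _ ⟨q, ⟨hq, hq0⟩, rfl⟩
        have := hψ ((-q 0) • r p + p 0 • r q) (Finset.mem_union_right _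
          (Finset.mem_image.2 ⟨(p, q), by simp [hp, hp0, hq, hq0], rfl⟩))
        rw [map_add, map_zsmul, map_zsmul, zsmul_eq_mul, zsmul_eq_mul, Int.cast_neg] at this
        have hp' : (0 : ℚ) < p 0 := by exact_mod_cast hp0
        have hq' : (q 0 : ℚ) < 0 := by exact_mod_cast hq0
        rw [div_lt_div_iff₀ hp' (by linarith)]
        linarith)
    refine ⟨ψ.comp r + (AddMonoidHom.mulRight t).comp
      ((Int.castAddHom ℚ).comp (Pi.evalAddMonoidHom (fun _ => ℤ) 0)), fun s hs => ?_⟩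
    change 0 < ψ (r s) + (s 0 : ℚ) * t
    rcases lt_trichotomy (s 0) 0 with h0 | h0 | h0
    · have := hhi _ (Finset.mem_image_of_mem _ (Finset.mem_filter.2 ⟨hs, h0⟩))
      have h0' : (s 0 : ℚ) < 0 := by exact_mod_cast h0
      rw [lt_div_iff₀ (by linarith)] at this
      linarith
    · rw [h0, Int.cast_zero, zero_mul, add_zero]
      exact hψ _ (Finset.mem_union_left _
        (Finset.mem_image_of_mem _ (Finset.mem_filter.2 ⟨hs, h0⟩)))
    · have := hlo _ (Finset.mem_image_of_mem _ (Finset.mem_filter.2 ⟨hs, h0⟩))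
      have h0' : (0 : ℚ) < s 0 := by exact_mod_cast h0
      rw [div_lt_iff₀ h0'] at this
      linarith

/-- Finitely many positive elements of a linearly ordered abelian group are made positive by a
single homomorphism to `ℚ`. -/
theorem exists_addMonoidHom_rat_pos (S : Finset G) (hS : ∀ s ∈ S, 0 < s) :
    ∃ φ : G →+ ℚ, ∀ s ∈ S, 0 < φ s := by
  classical
  let H : Submodule ℤ G := Submodule.span ℤ (S : Set G)
  have : Module.Finite ℤ H := Module.Finite.span_finset ℤ S
  -- The span of `S` is finitely generated and torsion-free, hence free. A map on it extends to `G`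
  -- because `ℚ` is divisible.
  obtain ⟨n, b⟩ := Module.basisOfFiniteTypeTorsionFree' (R := ℤ) (M := H)
  let e : H ≃ₗ[ℤ] (Fin n → ℤ) := b.equivFun
  obtain ⟨φ, hφ⟩ := exists_addMonoidHom_rat_pos_of_pi n
    (H.subtype.comp e.symm.toLinearMap).toAddMonoidHom
    (S.attach.image (fun s : {x // x ∈ S} => e ⟨s.1, Submodule.subset_span s.2⟩)) (by
      intro v hv
      obtain ⟨s, -, rfl⟩ := Finset.mem_image.1 hv
      simpa using hS s.1 s.2)
  obtain ⟨Φ, hΦ⟩ := (Module.Baer.of_divisible ℚ).extension_property_addMonoidHom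
    H.subtype.toAddMonoidHom H.injective_subtype (φ.comp e.toLinearMap.toAddMonoidHom)
  refine ⟨Φ, fun s hs => ?_⟩
  have h1 : Φ s = φ (e ⟨s, Submodule.subset_span hs⟩) :=
    DFunLike.congr_fun hΦ ⟨s, Submodule.subset_span hs⟩
  rw [h1]
  exact hφ _ (Finset.mem_image.2 ⟨⟨s, hs⟩, Finset.mem_attach _ _, rfl⟩)

/-- On a finite subset, a linearly ordered abelian group is mapped strictly monotonically to `ℚ`
by some homomorphism. -/
theorem exists_addMonoidHom_rat_strictMonoOn (E : Finset G) :
    ∃ φ : G →+ ℚ, StrictMonoOn φ (E : Set G) := by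
  classical
  obtain ⟨φ, hφ⟩ := exists_addMonoidHom_rat_pos
    (((E ×ˢ E).image (fun p => p.2 - p.1)).filter (fun g => 0 < g))
    (fun s hs => (Finset.mem_filter.1 hs).2)
  refine ⟨φ, fun a ha b hb hab => ?_⟩
  rw [← sub_pos, ← map_sub]
  exact hφ _ (Finset.mem_filter.2 ⟨Finset.mem_image.2 ⟨(a, b), Finset.mem_product.2 ⟨ha, hb⟩, rfl⟩,
    sub_pos.2 hab⟩)

end OrderedGroup

namespace MVAlgebra

/-! ### The partial addition of an MV-algebra -/

section PartialSum

variable {M : Type*} [MVAlgebra M] {a b c d e a' : M}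

theorem neg_one : neg (one : M) = zero := neg_neg zero

theorem oplus_one' (a : M) : oplus a one = one := oplus_one a

theorem one_oplus (a : M) : oplus one a = one := by rw [oplus_comm, oplus_one']

theorem zero_oplus (a : M) : oplus zero a = a := by rw [oplus_comm, oplus_zero]

theorem neg_oplus_self (a : M) : oplus (neg a) a = one := by
  have := lukasiewicz a one
  rw [oplus_one', neg_one, zero_oplus] at this
  exact this.symm

theorem oplus_neg_self (a : M) : oplus a (neg a) = one := by
  rw [oplus_comm, neg_oplus_self]

theorem neg_injective : Function.Injective (neg : M → M) :=
  Function.LeftInverse.injective neg_neg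

/-- `IsSum a b c` says that `a ≤ ¬b` and `a ⊕ b = c`: in the enveloping group, `a + b = c`. -/
def IsSum (a b c : M) : Prop := oplus (neg a) (neg b) = one ∧ oplus a b = c

namespace IsSum

theorem symm (h : IsSum a b c) : IsSum b a c :=
  ⟨by rw [oplus_comm, h.1], by rw [oplus_comm, h.2]⟩

theorem zero_right (a : M) : IsSum a zero a := ⟨oplus_one _, oplus_zero a⟩

theorem zero_left (a : M) : IsSum zero a a := (zero_right a).symm

theorem self_neg (a : M) : IsSum a (neg a) one :=
  ⟨by rw [neg_neg, neg_oplus_self], oplus_neg_self a⟩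

/-- The Łukasiewicz axiom for `¬a` and `b`: one side collapses to `¬a` because `¬b ⊕ ¬a = 1`.
Cancellation and rotation of partial sums follow from this. -/
theorem neg_left_eq (h : IsSum a b c) : neg a = oplus (neg c) b := by
  have := lukasiewicz (neg a) b
  rw [neg_neg, h.2, oplus_comm (neg b), h.1, neg_one, zero_oplus] at this
  exact this.symm

/-- `a + b = c` gives `b + ¬c = ¬a`. -/
theorem rotate (h : IsSum a b c) : IsSum b (neg c) (neg a) := by
  refine ⟨?_, by rw [h.neg_left_eq, oplus_comm]⟩
  rw [neg_neg, ← h.2, oplus_comm a, oplus_assoc, neg_oplus_self, one_oplus]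

theorem right_cancel (h : IsSum a b c) (h' : IsSum a' b c) : a = a' :=
  neg_injective (by rw [h.neg_left_eq, h'.neg_left_eq])

theorem left_eq_neg (h : IsSum a b one) : a = neg b :=
  h.right_cancel (self_neg b).symm

/-- Associativity of the partial addition. -/
theorem assoc (h : IsSum a b c) (h' : IsSum c d e) : ∃ f, IsSum b d f ∧ IsSum a f e := by
  have hbd : oplus (neg b) (neg d) = one := by
    rw [h.symm.neg_left_eq, oplus_comm (neg c), ← oplus_assoc, h'.1, oplus_one']
  have hb : oplus b (neg (oplus b d)) = neg d := by
    have := lukasiewicz (neg d) b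
    rw [neg_neg, hbd, neg_one, zero_oplus] at this
    rw [oplus_comm, oplus_comm b d, this]
  refine ⟨oplus b d, ⟨hbd, rfl⟩, ?_, ?_⟩
  · rw [h.neg_left_eq, ← oplus_assoc, hb, h'.1]
  · rw [oplus_assoc, h.2, h'.2]

theorem assoc_symm {f : M} (h : IsSum b d f) (h' : IsSum a f e) :
    ∃ c, IsSum a b c ∧ IsSum c d e := by
  obtain ⟨c, h₁, h₂⟩ := h.symm.assoc h'.symm
  exact ⟨c, h₁.symm, h₂.symm⟩

theorem carry_symm (h : IsSum a (neg b) c) : IsSum a (neg c) b := by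
  have := h.rotate.rotate
  rw [neg_neg, neg_neg] at this
  exact this.symm

theorem eq_zero_of_one (h : IsSum a one c) : a = zero := by
  have := h.1
  rw [neg_one, oplus_zero] at this
  exact neg_injective this

theorem ne_one_left (h : IsSum a b c) (hc : c ≠ one) : a ≠ one := by
  rintro rfl
  exact hc (by rw [← h.2, one_oplus])

theorem total_eq (h : IsSum a b c) (h' : IsSum a b d) : c = d := h.2.symm.trans h'.2

end IsSum

theorem isSum_sub (h : le a b) : IsSum (neg (oplus (neg b) a)) a b := by
  have h : oplus (neg a) b = one := h
  refine ⟨?_, ?_⟩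
  · rw [neg_neg, ← oplus_assoc, oplus_neg_self, oplus_one']
  · rw [lukasiewicz, h, neg_one, zero_oplus]

end PartialSum

/-! ### The enveloping group of an MV-chain -/

section ChangGroup

/-- The carrier of the enveloping group of an MV-chain: `(n, x)` stands for `n · 1 + x`. -/
structure ChangGroup (M : Type*) [MVAlgebra M] where
  int : ℤ
  frac : M
  frac_ne_one : frac ≠ one

namespace ChangGroup

variable {M : Type*} [MVAlgebra M]

theorem eq_of_eq {g h : ChangGroup M} (h₁ : g.int = h.int) (h₂ : g.frac = h.frac) : g = h := by
  cases g
  cases h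
  cases h₁
  cases h₂
  rfl

open Classical in
/-- Addition of integer and fractional parts with carry. -/
noncomputable def add (g h : ChangGroup M) : ChangGroup M :=
  if H : oplus g.frac h.frac = one then
    ⟨g.int + h.int + 1, neg (oplus (neg g.frac) (neg h.frac)), fun hp => g.frac_ne_one <| by
      have hs : IsSum (neg (oplus (neg g.frac) (neg h.frac))) (neg h.frac) g.frac :=
        isSum_sub (by rw [le, neg_neg, oplus_comm, H])
      rw [← hs.2, hp, one_oplus]⟩
  else ⟨g.int + h.int, oplus g.frac h.frac, H⟩

theorem add_of_isSum {g h : ChangGroup M} {s : M} (H : IsSum g.frac h.frac s) (hs : s ≠ one) :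
    add g h = ⟨g.int + h.int, s, hs⟩ := by
  have h2 := H.2
  subst h2
  rw [add, dif_neg hs]

/-- The hypothesis encodes `p = g.frac + h.frac - 1` without leaving `M`. -/
theorem add_of_carry {g h : ChangGroup M} {p : M} (H : IsSum p (neg h.frac) g.frac) :
    add g h = ⟨g.int + h.int + 1, p, H.ne_one_left g.frac_ne_one⟩ := by
  have h1 : oplus g.frac h.frac = one := by
    rw [← H.2, ← oplus_assoc, neg_oplus_self, oplus_one']
  rw [add, dif_pos h1]
  refine eq_of_eq rfl ?_
  exact (isSum_sub (by rw [le, neg_neg, oplus_comm, h1])).right_cancel H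

/-- This is where linearity enters: if `x ⊕ y ≠ 1`, then `¬x ≤ y` fails, so `y ≤ ¬x` and the partial
sum exists. -/
theorem isSum_or_carry (hM : IsLinearlyOrdered M) (x y : M) :
    (∃ s, IsSum x y s ∧ s ≠ one) ∨ ∃ p, IsSum p (neg y) x := by
  by_cases h : oplus x y = one
  · exact Or.inr ⟨_, isSum_sub (by rw [le, neg_neg, oplus_comm, h])⟩
  · refine Or.inl ⟨_, ⟨?_, rfl⟩, h⟩
    rcases hM (neg x) y with h' | h'
    · rw [le, neg_neg] at h'
      exact absurd h' h
    · rw [oplus_comm]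
      exact h'

theorem add_comm (g h : ChangGroup M) : add g h = add h g := by
  by_cases H : oplus g.frac h.frac = one
  · have H' : oplus h.frac g.frac = one := by rw [oplus_comm, H]
    rw [add, add, dif_pos H, dif_pos H']
    exact eq_of_eq (by simp only [_root_.add_comm]) (by simp only [oplus_comm])
  · have H' : oplus h.frac g.frac ≠ one := by rwa [oplus_comm]
    rw [add, add, dif_neg H, dif_neg H']
    exact eq_of_eq (by simp only [_root_.add_comm]) (by simp only [oplus_comm])

/-- The case of associativity in which the second sum carries and the first does not. -/
theorem add_assoc_of_carry_right {g h k : ChangGroup M} {s q : M}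
    (hs : IsSum g.frac h.frac s) (hs1 : s ≠ one) (hq : IsSum q (neg k.frac) h.frac) :
    add (add g h) k = add g (add h k) := by
  obtain ⟨r, hr, hr'⟩ := hq.assoc_symm hs
  rw [add_of_isSum hs hs1, add_of_carry hq, add_of_carry (p := r) (by exact hr'),
    add_of_isSum (s := r) (by exact hr) (hr'.ne_one_left hs1)]
  exact eq_of_eq (by simp only; ring) rfl

theorem add_assoc (hM : IsLinearlyOrdered M) (g h k : ChangGroup M) :
    add (add g h) k = add g (add h k) := by
  rcases isSum_or_carry hM g.frac h.frac with ⟨s, hs, hs1⟩ | ⟨p, hp⟩ <;>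
  rcases isSum_or_carry hM h.frac k.frac with ⟨t, ht, ht1⟩ | ⟨q, hq⟩
  · rw [add_of_isSum hs hs1, add_of_isSum ht ht1]
    rcases isSum_or_carry hM s k.frac with ⟨w, hw, hw1⟩ | ⟨p, hp⟩
    · obtain ⟨t', ht', hw'⟩ := hs.assoc hw
      obtain rfl := ht.total_eq ht'
      rw [add_of_isSum (s := w) (by exact hw) hw1, add_of_isSum (s := w) (by exact hw') hw1]
      exact eq_of_eq (by simp only; ring) rfl
    -- If `s + k` carries, so does `g + t`: otherwise `w = g + t = s + k = p + ¬k + k = p + 1`,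
    -- forcing `w = 1`.
    · have hle : ∃ q, IsSum q (neg t) g.frac := by
        rcases isSum_or_carry hM g.frac t with ⟨w, hw, hw1⟩ | h'
        · exfalso
          obtain ⟨s', hs', hw'⟩ := ht.assoc_symm hw
          obtain rfl := hs.total_eq hs'
          obtain ⟨f, hf, hf'⟩ := hp.assoc hw'
          obtain rfl := hf.total_eq (IsSum.self_neg _).symm
          exact hw1 (by rw [← hf'.2, oplus_one'])
        · exact h'
      obtain ⟨q, hq⟩ := hle
      -- `¬k = h + ¬t`, so `s = g + h = q + ¬t + h = q + ¬k`
      have hk : IsSum (neg t) h.frac (neg k.frac) := ht.symm.rotate.symm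
      obtain ⟨f, hf, hf'⟩ := hq.assoc hs
      obtain rfl := hf.total_eq hk
      obtain rfl := hp.right_cancel hf'
      rw [add_of_carry (p := p) (by exact hp), add_of_carry (p := p) (by exact hq)]
      exact eq_of_eq (by simp only; ring) rfl
  · exact add_assoc_of_carry_right hs hs1 hq
  · rw [add_comm g h, add_comm _ k, add_comm h k, add_comm g]
    exact (add_assoc_of_carry_right ht.symm ht1 hp.carry_symm).symm
  · rw [add_of_carry hp, add_of_carry hq]
    rcases isSum_or_carry hM p k.frac with ⟨w, hw, hw1⟩ | ⟨r, hr⟩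
    · -- `¬k = p + ¬w`, so `q + ¬w + p = h = ¬g + p`
      obtain ⟨c, hc, hc'⟩ := hw.symm.rotate.symm.assoc_symm hq
      obtain rfl := hc'.right_cancel hp.carry_symm.symm
      have hg : IsSum g.frac q w := by
        have := hc.rotate.rotate
        rwa [neg_neg, neg_neg, neg_neg] at this
      rw [add_of_isSum (s := w) (by exact hw) hw1, add_of_isSum (s := w) (by exact hg) hw1]
      exact eq_of_eq (by simp only; ring) rfl
    -- Here `h = p + ¬g = ¬k + r + ¬g`, so `q = r + ¬g`, and `g + q` carries with the same remainder
    -- `r`.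
    · obtain ⟨f, hf, hf'⟩ := hr.symm.assoc hp.carry_symm
      obtain rfl := hf'.symm.right_cancel hq
      rw [add_of_carry (p := r) (by exact hr), add_of_carry (p := r) (by exact hf.carry_symm)]
      exact eq_of_eq (by simp only; ring) rfl

open Classical in
/-- The additive inverse in the enveloping group. -/
noncomputable def negate (hne : (zero : M) ≠ one) (g : ChangGroup M) : ChangGroup M :=
  -- `¬0 = 1` is not an admissible fractional part; otherwise `-(n + x) = (-n - 1) + ¬x`.
  if h : g.frac = zero then ⟨-g.int, zero, hne⟩
  else ⟨-g.int - 1, neg g.frac, fun h₁ => h (neg_injective h₁)⟩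

/-- The enveloping group of a nontrivial MV-chain. -/
noncomputable abbrev addCommGroup (hM : IsLinearlyOrdered M) (hne : (zero : M) ≠ one) :
    AddCommGroup (ChangGroup M) :=
  letI : Add (ChangGroup M) := ⟨add⟩
  letI : Zero (ChangGroup M) := ⟨⟨0, zero, hne⟩⟩
  letI : Neg (ChangGroup M) := ⟨negate hne⟩
  have hzero (g : ChangGroup M) : 0 + g = g :=
    (add_of_isSum (g := ⟨0, zero, hne⟩) (IsSum.zero_left g.frac) g.frac_ne_one).trans
      (eq_of_eq (_root_.zero_add _) rfl)
  { add_assoc := add_assoc hM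
    add_comm := add_comm
    zero_add := hzero
    add_zero := fun g => (add_comm g 0).trans (hzero g)
    nsmul := nsmulRec
    zsmul := zsmulRec
    neg_add_cancel := fun g => by
      change add (negate hne g) g = ⟨0, zero, hne⟩
      rw [negate]
      split_ifs with h
      · rw [add_of_isSum (s := zero) (by rw [h]; exact IsSum.zero_left zero) hne]
        exact eq_of_eq (neg_add_cancel _) rfl
      · rw [add_of_carry (p := zero) (IsSum.zero_left _)]
        exact eq_of_eq (by simp only; ring) rfl }

/-- The cone of elements of the enveloping group with nonnegative integer part. -/
noncomputable abbrev cone (hM : IsLinearlyOrdered M) (hne : (zero : M) ≠ one) :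
    letI := addCommGroup hM hne
    AddGroupCone (ChangGroup M) :=
  letI := addCommGroup hM hne
  { carrier := {g | 0 ≤ g.int}
    zero_mem' := le_refl (0 : ℤ)
    add_mem' := fun {g h} (hg : 0 ≤ g.int) (hh : 0 ≤ h.int) => by
      change 0 ≤ (add g h).int
      rw [add]
      split_ifs
      · change 0 ≤ g.int + h.int + 1
        omega
      · exact add_nonneg hg hh
    eq_zero_of_mem_of_neg_mem' := fun {g} (hg : 0 ≤ g.int) hg' => by
      change 0 ≤ (negate hne g).int at hg'
      rw [negate] at hg'
      split_ifs at hg' with h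
      · change 0 ≤ -g.int at hg'
        exact eq_of_eq (show g.int = 0 by omega) h
      · change 0 ≤ -g.int - 1 at hg'
        omega }

theorem cone_total (hM : IsLinearlyOrdered M) (hne : (zero : M) ≠ one) :
    letI := addCommGroup hM hne
    HasMemOrNegMem (cone hM hne) := by
  let _ := addCommGroup hM hne
  refine ⟨fun g => ?_⟩
  change 0 ≤ g.int ∨ 0 ≤ (negate hne g).int
  rw [negate]
  split_ifs
  · change 0 ≤ g.int ∨ 0 ≤ -g.int
    omega
  · change 0 ≤ g.int ∨ 0 ≤ -g.int - 1
    omega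

open Classical in
/-- The inclusion of an MV-chain into its enveloping group. -/
noncomputable def of (hne : (zero : M) ≠ one) (x : M) : ChangGroup M :=
  if h : x = one then ⟨1, zero, hne⟩ else ⟨0, x, h⟩

theorem of_one (hne : (zero : M) ≠ one) : of hne one = ⟨1, zero, hne⟩ := dif_pos rfl

theorem of_of_ne (hne : (zero : M) ≠ one) {x : M} (hx : x ≠ one) : of hne x = ⟨0, x, hx⟩ :=
  dif_neg hx

theorem of_injective (hne : (zero : M) ≠ one) : Function.Injective (of hne) := by
  intro x y h
  by_cases hx : x = one <;> by_cases hy : y = one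
  · rw [hx, hy]
  · subst hx
    rw [of_one, of_of_ne hne hy] at h
    exact absurd (congrArg int h) one_ne_zero
  · subst hy
    rw [of_one, of_of_ne hne hx] at h
    exact absurd (congrArg int h) zero_ne_one
  · rw [of_of_ne hne hx, of_of_ne hne hy] at h
    exact congrArg frac h

theorem of_int_nonneg (hne : (zero : M) ≠ one) (x : M) : 0 ≤ (of hne x).int := by
  rw [of]
  split_ifs
  · exact zero_le_one
  · exact le_rfl

theorem zero_add_of (hne : (zero : M) ≠ one) (g : ChangGroup M) : add (of hne zero) g = g := by
  rw [of_of_ne hne hne, add_of_isSum (IsSum.zero_left g.frac) g.frac_ne_one]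
  exact eq_of_eq (_root_.zero_add _) rfl

theorem add_of_of (hne : (zero : M) ≠ one) {a b c : M} (h : IsSum a b c) :
    add (of hne a) (of hne b) = of hne c := by
  by_cases ha : a = one
  · subst ha
    obtain rfl := h.symm.eq_zero_of_one
    rw [add_comm, zero_add_of, ← h.2, oplus_zero]
  by_cases hb : b = one
  · subst hb
    obtain rfl := h.eq_zero_of_one
    rw [zero_add_of, ← h.2, zero_oplus]
  rw [of_of_ne hne ha, of_of_ne hne hb]
  by_cases hc : c = one
  · subst hc
    rw [add_of_carry (p := zero) (by
      rw [← h.left_eq_neg]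
      exact IsSum.zero_left a), of_one]
    exact eq_of_eq (by simp) rfl
  · rw [add_of_isSum (s := c) h hc, of_of_ne hne hc]
    exact eq_of_eq (by simp) rfl

end ChangGroup

universe u

/-- A nontrivial MV-chain is a unit interval `[0, u]` of a linearly ordered abelian group. -/
theorem exists_orderedGroup_embedding {M : Type u} [MVAlgebra M] (hM : IsLinearlyOrdered M)
    (hne : (zero : M) ≠ one) :
    ∃ (G : Type u) (_ : AddCommGroup G) (_ : LinearOrder G) (_ : IsOrderedAddMonoid G) (u : G)
      (ι : M → G), 0 < u ∧ Function.Injective ι ∧ (∀ x, 0 ≤ ι x) ∧ (∀ x, ι x ≤ u) ∧ ι zero = 0 ∧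
      (∀ x, ι (neg x) = u - ι x) ∧ ∀ x y, ι (oplus x y) = min (ι x + ι y) u := by
  classical
  let _ := ChangGroup.addCommGroup hM hne
  have := ChangGroup.cone_total hM hne
  let _ : LinearOrder (ChangGroup M) := LinearOrder.mkOfAddGroupCone (ChangGroup.cone hM hne)
  have : IsOrderedAddMonoid (ChangGroup M) := IsOrderedAddMonoid.mkOfCone (ChangGroup.cone hM hne)
  have hinj := ChangGroup.of_injective hne
  have hnonneg (x : M) : 0 ≤ ChangGroup.of hne x := by
    have : ChangGroup.of hne x - 0 ∈ ChangGroup.cone hM hne := by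
      rw [sub_zero]
      exact ChangGroup.of_int_nonneg hne x
    exact this
  have hsum {a b c : M} (h : IsSum a b c) :
      ChangGroup.of hne a + ChangGroup.of hne b = ChangGroup.of hne c :=
    ChangGroup.add_of_of hne h
  have hzero : ChangGroup.of hne zero = 0 := by
    have := hsum (IsSum.zero_left (zero : M))
    exact add_eq_left.1 this
  have hneg (x : M) : ChangGroup.of hne (neg x) = ChangGroup.of hne one - ChangGroup.of hne x := by
    rw [← hsum (IsSum.self_neg x), add_sub_cancel_left]
  have hle (x : M) : ChangGroup.of hne x ≤ ChangGroup.of hne one := by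
    have := hnonneg (neg x)
    rwa [hneg, sub_nonneg] at this
  refine ⟨ChangGroup M, inferInstance, inferInstance, inferInstance, ChangGroup.of hne one,
    ChangGroup.of hne, ?_, hinj, hnonneg, hle, hzero, hneg, fun x y => ?_⟩
  · refine lt_of_le_of_ne (hnonneg one) fun h => hne (hinj ?_)
    rw [hzero, h]
  · rcases ChangGroup.isSum_or_carry hM x y with ⟨s, hs, -⟩ | ⟨p, hp⟩
    · rw [hsum hs, hs.2, min_eq_left (hle s)]
    · have h1 : oplus x y = one := by
        rw [← hp.2, ← oplus_assoc, neg_oplus_self, oplus_one']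
      -- In the carry case `ι x + ι y = ι p + u ≥ u`, so the minimum is `u`.
      rw [h1, ← hsum hp, hneg, min_eq_right]
      rw [add_assoc, sub_add_cancel]
      exact le_add_of_nonneg_left (hnonneg p)

end ChangGroup

/-! ### Passage to rational chains -/

/-- Finitely many rationals have a common denominator. -/
theorem exists_common_denominator {α : Type*} [Finite α] (g : α → ℚ) :
    ∃ k : ℕ+, ∀ x, ∃ i : ℤ, g x = i / ((k : ℕ) : ℚ) := by
  classical
  have := Fintype.ofFinite α
  refine ⟨⟨∏ x, (g x).den, Finset.prod_pos fun x _ => (g x).pos⟩, fun x => ?_⟩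
  obtain ⟨m, hm⟩ := Finset.dvd_prod_of_mem (fun x => (g x).den) (Finset.mem_univ x)
  have hpos : (∏ x, (g x).den) ≠ 0 := (Finset.prod_pos fun x _ => (g x).pos).ne'
  refine ⟨(g x).num * m, ?_⟩
  have hm0 : (m : ℚ) ≠ 0 := by
    rintro h
    apply hpos
    rw [hm, Nat.cast_eq_zero.1 h, mul_zero]
  rw [PNat.mk_coe, hm, Nat.cast_mul, Int.cast_mul, Int.cast_natCast,
    mul_div_mul_right _ _ hm0, Rat.num_div_den]

/-- An embedding into `ℚ ∩ [0,1]` of a finite restriction of an MV-chain. -/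
theorem exists_isEmbedding_ratUnit {M : Type*} [MVAlgebra M] (hM : IsLinearlyOrdered M)
    (hne : (zero : M) ≠ one) (X : Set M) (hX : X.Finite) :
    ∃ f : X → Set.Icc (0 : ℚ) 1, (PartialMVAlgebra.restrict M X).IsEmbedding f := by
  classical
  obtain ⟨G, _, _, _, u, ι, hu, hinj, hnonneg, hle, hzero, hneg, hadd⟩ :=
    exists_orderedGroup_embedding hM hne
  let I : Finset G := hX.toFinset.image ι
  have hI (x : X) : ι x ∈ I := Finset.mem_image_of_mem _ (hX.mem_toFinset.2 x.2)
  -- The sums are taken in `G` and may exceed `u`; including them lets `φ` commute with the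
  -- truncation `min (ι x + ι y) u`.
  let E : Finset G := {0, u} ∪ I ∪ (I ×ˢ I).image (fun p => p.1 + p.2)
  have h0E : 0 ∈ E := by simp [E]
  have huE : u ∈ E := by simp [E]
  have hιE (x : X) : ι x ∈ E := Finset.mem_union_left _ (Finset.mem_union_right _ (hI x))
  have hsE (x y : X) : ι x + ι y ∈ E := Finset.mem_union_right _
    (Finset.mem_image.2 ⟨(ι x, ι y), Finset.mem_product.2 ⟨hI x, hI y⟩, rfl⟩)
  obtain ⟨φ, hφ⟩ := exists_addMonoidHom_rat_strictMonoOn E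
  have hφu : 0 < φ u := by
    have := hφ h0E huE hu
    rwa [map_zero] at this
  refine ⟨fun x => ⟨φ (ι x) / φ u, div_nonneg ?_ hφu.le, (div_le_one hφu).2 ?_⟩, ?_, ?_, ?_, ?_⟩
  · have := hφ.monotoneOn h0E (hιE x) (hnonneg x)
    rwa [map_zero] at this
  · exact hφ.monotoneOn (hιE x) huE (hle x)
  · intro x y h
    have h : φ (ι x) / φ u = φ (ι y) / φ u := congrArg Subtype.val h
    rw [div_left_inj' hφu.ne'] at h
    exact Subtype.ext (hinj (hφ.injOn (hιE x) (hιE y) h))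
  · rintro x y _ ⟨hz, rfl⟩
    apply Subtype.ext
    change φ (ι (oplus x.1 y.1)) / φ u = min (φ (ι x) / φ u + φ (ι y) / φ u) 1
    rw [hadd, hφ.monotoneOn.map_min (hsE x y) huE, map_add, ← min_div_div_right hφu.le, add_div,
      div_self hφu.ne']
  · rintro x _ ⟨hz, rfl⟩
    apply Subtype.ext
    change φ (ι (neg x.1)) / φ u = 1 - φ (ι x) / φ u
    rw [hneg, map_sub, sub_div, div_self hφu.ne']
  · rintro _ ⟨hz, rfl⟩
    apply Subtype.ext
    change φ (ι zero) / φ u = 0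
    rw [hzero, map_zero, zero_div]

end MVAlgebra

theorem lemma2 {M : Type*} [MVAlgebra M] (hM : MVAlgebra.IsLinearlyOrdered M)
    (hne : (MVAlgebra.zero : M) ≠ MVAlgebra.one) (X : Set M) (hX : X.Finite) :
    ∃ (k : ℕ+) (f : X → MVAlgebra.FiniteChain k),
      (PartialMVAlgebra.restrict M X).IsEmbedding f ∧
      (PartialMVAlgebra.restrict M X).IsEmbedding
        (fun x => ((f x : MVAlgebra.FiniteChain k) : Set.Icc (0 : ℚ) 1)) := by
  obtain ⟨f, hf⟩ := MVAlgebra.exists_isEmbedding_ratUnit hM hne X hX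
  have := hX.to_subtype
  obtain ⟨k, hk⟩ := MVAlgebra.exists_common_denominator (fun x => (f x : ℚ))
  have hk0 : (0 : ℚ) < ((k : ℕ) : ℚ) := by exact_mod_cast k.pos
  have hmem (x : X) : ∃ i : ℕ, i ≤ (k : ℕ) ∧ (f x : ℚ) = (i : ℚ) / ((k : ℕ) : ℚ) := by
    obtain ⟨i, hi⟩ := hk x
    have hi0 : (0 : ℚ) ≤ i := by
      have := (f x).2.1
      rw [hi] at this
      exact by rwa [le_div_iff₀ hk0, zero_mul] at this
    have hi1 : (i : ℚ) ≤ (k : ℕ) := by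
      have := (f x).2.2
      rw [hi] at this
      exact (div_le_one hk0).1 this
    lift i to ℕ using (by exact_mod_cast hi0)
    exact ⟨i, by exact_mod_cast hi1, by simpa using hi⟩
  refine ⟨k, fun x => ⟨f x, hmem x⟩, ⟨fun x y h => hf.injective (congrArg Subtype.val h),
    fun x y z hz => Subtype.ext (hf.map_oplus x y z hz),
    fun x z hz => Subtype.ext (hf.map_neg x z hz),
    fun z hz => Subtype.ext (hf.map_zero z hz)⟩, hf⟩
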